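/- Setting. Let $\mathbb X$ be a real Hausdorff locally convex space in which the closed convex hull of every metrizable compact set is compact, let $\mathbb X'$ be its topological dual, and let $\mathbb X^+\subset\mathbb X$ be a closed proper cone (i.e. $\mathbb X^+\cap(-\mathbb X^+)=\{0\}$) with dual cone $\mathbb X'^+=\{\varphi\in\mathbb X' : \langle\varphi,x\rangle\ge 0 \text{ for all } x\in\mathbb X^+\}$. Let $\pi$ be a norm on $\mathbb X$ such that $(\mathbb X,\pi)$ is a Banach space and $(\mathbb X,\mathbb X')$ is a norming dual pair: every $\varphi\in\mathbb X'$ is $\pi$-bounded, $\mathbb X'$ is closed in the Banach dual of $(\mathbb X,\pi)$, and, writing $\pi$ also for the dual norm on $\mathbb X'$, $\pi(x)=\sup\{|\langle\varphi,x\rangle| : \varphi\in\mathbb X',\ \pi(\varphi)\le 1\}$ for all $x\in\mathbb X$. Assume that $\mathbb X'^+$ is generating: $\mathbb X'=\mathbb X'^+-\mathbb X'^+$. A $C_b$ semigroup on $\mathbb X$ is a family of continuous linear operators $\mathcal T(t)$, $t\ge0$, such that $\mathcal T(0)=I$ and $\mathcal T(t+s)=\mathcal T(t)\mathcal T(s)$;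 $t\mapsto\mathcal T(t)x$ is continuous on $[0,\infty)$ for every $x$; and for every continuous seminorm $p$ and $a>0$ the function $x\mapsto\sup_{0\le t\le a}p(\mathcal T(t)x)$ is bounded on bounded sets. It is positive if $\mathcal T(t)\mathbb X^+\subseteq\mathbb X^+$ for all $t\ge0$. With $\mathcal T'(t)\varphi=\varphi\circ\mathcal T(t)$, it is $\pi$-compatible if $t\mapsto\pi(\mathcal T'(t)\varphi)$ is continuous on $[0,\infty)$ for every $\varphi\in\mathbb X'^+$. It is $L^1$ $\pi$-stable on a set $\mathcal F\subseteq\mathbb X'^+$ if $\int_0^\infty\pi(\mathcal T'(t)\varphi)\,dt<\infty$ for all $\varphi\in\mathcal F$, and $L^1$ $\pi$-stable if this holds for $\mathcal F=\mathbb X'^+$. It is exponentially $\pi$-stable if there are $M,\varepsilon>0$ with $\pi(\mathcal T(t)x)\le Me^{-\varepsilon t}\pi(x)$ for all $t\ge0$, $x\in\mathbb X$. Its generator is $\mathcal A x=\lim_{t\to0+}\frac1t(\mathcal T(t)x-x)$, with domain $\mathcal D_{\mathcal A}$ the set of $x$ for which the limit exists in the topology of $\mathbb X$. A subset $\mathcal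 F\subseteq\mathbb X'^+$ is an $L^1$ $\pi$-stability subset for a class $\mathcal C$ of positive $\pi$-compatible $C_b$ semigroups if every semigroup of the class that is $L^1$ $\pi$-stable on $\mathcal F$ is $L^1$ $\pi$-stable. An element $z\in\mathbb X^+$ is an $L^1$ $\pi$-detector for $\mathcal T(t)$ relative to $\mathcal F$ if for every $\varphi\in\mathcal F$, $\int_0^\infty\langle\varphi,\mathcal T(t)z\rangle\,dt<\infty$ implies $\int_0^\infty\pi(\mathcal T'(t)\varphi)\,dt<\infty$. Theorem. Let $\mathcal T(t)$ be a positive $\pi$-compatible $C_b$ semigroup on $\mathbb X$ with generator $\mathcal A$, let $\mathcal F\subseteq\mathbb X'^+$ be an $L^1$ $\pi$-stability subset for some class of positive $\pi$-compatible $C_b$ semigroups on $\mathbb X$ that contains $\mathcal T(t)$, and let $z\in\mathbb X^+$ be an $L^1$ $\pi$-detector for $\mathcal T(t)$ relative to $\mathcal F$. Then the following conditions are equivalent: (i) $\mathcal A x=-z$ has a positive solution $x\in\mathcal D_{\mathcal A}\cap\mathbb X^+$; (ii)$'$ $\mathcal T(t)$ is $L^1$ $\pi$-stable; (ii) $\mathcal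 T(t)$ is exponentially $\pi$-stable; (iii) $\mathcal A$ has a $\pi$-bounded inverse defined on all of $\mathbb X$, i.e. there is a $\pi$-bounded linear operator $\mathcal A^{-1}:\mathbb X\to\mathcal D_{\mathcal A}$ with $\mathcal A\mathcal A^{-1}x=x$ for all $x\in\mathbb X$ and $\mathcal A^{-1}\mathcal A x=x$ for all $x\in\mathcal D_{\mathcal A}$, and $-\mathcal A^{-1}x\in\mathbb X^+$ for all $x\in\mathbb X^+$. -/

import Mathlib

open Set Filter Topology MeasureTheory
open scoped ENNReal

namespace LyapunovPair

/-- Compactness of convex closures: closed convex hulls of metrizable compact sets are compact. -/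
def CompactConvexClosures (E : Type*) [AddCommGroup E] [Module ℝ E] [TopologicalSpace E] : Prop :=
  ∀ K : Set E, IsCompact K → TopologicalSpace.MetrizableSpace K →
    IsCompact (closure (convexHull ℝ K))

section Pairs

variable {E : Type*} [AddCommGroup E] [Module ℝ E] [TopologicalSpace E]

/-- The dual norm `sup {|φ x| : π x ≤ 1}` of a functional `φ ∈ E'`. It is only used when all
functionals in `E'` are `π`-bounded, so that the supremum is finite. -/
noncomputable def dualNorm (π : Seminorm ℝ E) (φ : StrongDual ℝ E) : ℝ :=
  sSup {r : ℝ | ∃ x : E, π x ≤ 1 ∧ r = |φ x|}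

/-- `E` is a Banach space for the norm `π`. -/
structure IsBanachNorm (π : Seminorm ℝ E) : Prop where
  eq_zero : ∀ x, π x = 0 → x = 0
  complete : ∀ u : ℕ → E,
    (∀ ε > 0, ∃ N, ∀ m ≥ N, ∀ n ≥ N, π (u m - u n) < ε) →
      ∃ x, Tendsto (fun n => π (u n - x)) atTop (𝓝 0)

/-- The space `E` with the Banach norm `π`, and the dual `E'` of `E` for its locally convex
topology, form a norming dual pair: `E'` is a norm closed subspace of the Banach dual of `(E, π)`,
and it is norming for `π`. -/
structure IsNormingDualPair (π : Seminorm ℝ E) : Prop where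
  banach : IsBanachNorm π
  /-- every `φ ∈ E'` is bounded with respect to `π` -/
  bounded : ∀ φ : StrongDual ℝ E, ∃ C : ℝ, ∀ x, |φ x| ≤ C * π x
  /-- a linear functional that is a limit of elements of `E'` in the norm of the Banach dual
  belongs to `E'` -/
  closed : ∀ l : E →ₗ[ℝ] ℝ,
    (∀ ε > 0, ∃ φ : StrongDual ℝ E, ∀ x, |l x - φ x| ≤ ε * π x) → Continuous l
  norming : ∀ x : E, IsLUB {r : ℝ | ∃ φ : StrongDual ℝ E, dualNorm π φ ≤ 1 ∧ r = |φ x|} (π x)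

/-- The dual cone `E'⁺` of a cone `P = E⁺`. -/
def dualCone (P : Set E) : Set (StrongDual ℝ E) := {φ | ∀ x ∈ P, 0 ≤ φ x}

/-- `C_b` semigroups; only the values `T t` with `t ≥ 0` matter. -/
structure IsCbSemigroup (T : ℝ → E →L[ℝ] E) : Prop where
  zero : T 0 = ContinuousLinearMap.id ℝ E
  add : ∀ t ≥ 0, ∀ s ≥ 0, T (t + s) = (T t).comp (T s)
  continuousOn : ∀ x, ContinuousOn (fun t => T t x) (Ici 0)
  locally_bounded : ∀ p : Seminorm ℝ E, Continuous p → ∀ a > 0, ∀ B : Set E,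
    Bornology.IsVonNBounded ℝ B → ∃ C : ℝ, ∀ x ∈ B, ∀ t ∈ Icc 0 a, p (T t x) ≤ C

/-- Positivity with respect to the cone `P = E⁺`. -/
def IsPositive (P : Set E) (T : ℝ → E →L[ℝ] E) : Prop := ∀ t ≥ 0, ∀ x ∈ P, T t x ∈ P

/-- `π`-compatibility: `t ↦ π (T'(t) φ)` is continuous on `[0, ∞)` for all `φ ∈ E'⁺`.
Here `T'(t) φ = φ ∘ T(t)`. -/
def IsCompatible (π : Seminorm ℝ E) (P : Set E) (T : ℝ → E →L[ℝ] E) : Prop :=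
  ∀ φ ∈ dualCone P, ContinuousOn (fun t => dualNorm π (φ.comp (T t))) (Ici 0)

/-- `∫₀^∞ π (T'(t) φ) dt < ∞` for all `φ` in `F`. -/
def IsL1StableOn (π : Seminorm ℝ E) (F : Set (StrongDual ℝ E)) (T : ℝ → E →L[ℝ] E) : Prop :=
  ∀ φ ∈ F, ∫⁻ t in Ioi (0 : ℝ), ENNReal.ofReal (dualNorm π (φ.comp (T t))) < ∞

/-- `L¹ π`-stability. -/
def IsL1Stable (π : Seminorm ℝ E) (P : Set E) (T : ℝ → E →L[ℝ] E) : Prop :=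
  IsL1StableOn π (dualCone P) T

/-- Exponential `π`-stability. -/
def IsExpStable (π : Seminorm ℝ E) (T : ℝ → E →L[ℝ] E) : Prop :=
  ∃ M > 0, ∃ ε > 0, ∀ t ≥ 0, ∀ x, π (T t x) ≤ M * Real.exp (-ε * t) * π x

/-- `z ∈ E⁺` is an `L¹ π`-detector relative to `F`. -/
def IsL1Detector (π : Seminorm ℝ E) (P : Set E) (T : ℝ → E →L[ℝ] E)
    (F : Set (StrongDual ℝ E)) (z : E) : Prop :=
  z ∈ P ∧ ∀ φ ∈ F, ∫⁻ t in Ioi (0 : ℝ), ENNReal.ofReal (φ (T t z)) < ∞ →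
    ∫⁻ t in Ioi (0 : ℝ), ENNReal.ofReal (dualNorm π (φ.comp (T t))) < ∞

/-- `F ⊆ E'⁺` is an `L¹ π`-stability subset for a class `𝒞` of positive `π`-compatible
`C_b` semigroups: for each of them, stability on `F` implies stability on `E'⁺`. -/
def IsStabilitySubset (π : Seminorm ℝ E) (P : Set E) (𝒞 : Set (ℝ → E →L[ℝ] E))
    (F : Set (StrongDual ℝ E)) : Prop :=
  F ⊆ dualCone P ∧ ∀ S ∈ 𝒞, IsCbSemigroup S → IsPositive P S → IsCompatible π P S →
    IsL1StableOn π F S → IsL1Stable π P S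

end Pairs

section Generator

variable {E : Type*} [AddCommGroup E] [Module ℝ E] [TopologicalSpace E]
  [IsTopologicalAddGroup E] [ContinuousSMul ℝ E]

/-- The domain of the infinitesimal generator. -/
def generatorDomain (T : ℝ → E →L[ℝ] E) : Submodule ℝ E where
  carrier := {x | ∃ y, Tendsto (fun t : ℝ => t⁻¹ • (T t x - x)) (𝓝[>] 0) (𝓝 y)}
  zero_mem' := ⟨0, by simpa using tendsto_const_nhds⟩
  add_mem' := by
    rintro x x' ⟨y, hy⟩ ⟨y', hy'⟩
    refine ⟨y + y', (hy.add hy').congr fun t => ?_⟩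
    rw [map_add, ← smul_add]
    congr 1
    abel
  smul_mem' := by
    rintro c x ⟨y, hy⟩
    refine ⟨c • y, (hy.const_smul c).congr fun t => ?_⟩
    rw [map_smul, ← smul_sub, smul_comm]

/-- The infinitesimal generator `A x = lim_{t → 0+} (T(t) x - x) / t`, on the domain where the
limit exists in the locally convex topology. -/
noncomputable def generator [T2Space E] (T : ℝ → E →L[ℝ] E) : E →ₗ.[ℝ] E where
  domain := generatorDomain T
  toFun :=
    { toFun := fun x => Classical.choose x.2
      map_add' := by
        intro x x'
        refine tendsto_nhds_unique (Classical.choose_spec (x + x').2)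
          (((Classical.choose_spec x.2).add (Classical.choose_spec x'.2)).congr fun t => ?_)
        rw [Submodule.coe_add, map_add, ← smul_add]
        congr 1
        abel
      map_smul' := by
        intro c x
        refine tendsto_nhds_unique (Classical.choose_spec (c • x).2)
          (((Classical.choose_spec x.2).const_smul c).congr fun t => ?_)
        rw [Submodule.coe_smul, map_smul, ← smul_sub, smul_comm] }

theorem generator_tendsto [T2Space E] (T : ℝ → E →L[ℝ] E) (x : (generator T).domain) :
    Tendsto (fun t : ℝ => t⁻¹ • (T t x - x)) (𝓝[>] 0) (𝓝 (generator T x)) :=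
  Classical.choose_spec x.2

/-- The operator `A` has a `π`-bounded everywhere defined (two-sided) inverse `B = A⁻¹`, and
`-A⁻¹ ≥ 0` with respect to the cone `P`. -/
def HasNegPosBoundedInverse (π : Seminorm ℝ E) (P : Set E) (A : E →ₗ.[ℝ] E) : Prop :=
  ∃ B : E →ₗ[ℝ] E,
    (∀ x : E, ∃ h : B x ∈ A.domain, A ⟨B x, h⟩ = x) ∧
    (∀ x : A.domain, B (A x) = x) ∧
    (∃ C : ℝ, ∀ x, π (B x) ≤ C * π x) ∧
    ∀ x ∈ P, -B x ∈ P

end Generator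

end LyapunovPair

namespace LyapunovPair

/-! The cycle is (i) ⇒ `L¹` stability ⇒ exponential stability ⇒ (iii) ⇒ (i). If `A x = -z` with `x ≥
0`, then for positive `φ` the integral of `⟨φ, T(t) z⟩` over `[0, a]` is `⟨φ, x⟩ - ⟨φ, T(a) x⟩ ≤ ⟨φ,
x⟩`. The detector property turns this into stability on `F`, and the stability subset property
extends it to the dual cone.

The next implication is a Datko–Pazy argument (`IsL1Stable.isExpStable`). Integrability of `π (T'(t)
φ)` bounds first `T(t)` and then `t T(t)` pointwise on the generating dual cone. Uniform boundedness
on the Banach space `E'` (`IsNormingDualPair.exists_operator_bound`) makes both bounds uniform, so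
some `T(t₀)` has norm at most `1/2`.

Under exponential decay, `-A⁻¹ x` is the integral of `T(t) x` over the half-line. It exists weakly:
on bounded intervals by compactness of convex closures, then as a `π`-limit. Applied to `z`, it
solves (i). -/

theorem IsBanachNorm.pos {E : Type*} [AddCommGroup E] [Module ℝ E] {π : Seminorm ℝ E}
    (hπ : IsBanachNorm π) {x : E} (hx : x ≠ 0) : 0 < π x :=
  lt_of_le_of_ne (apply_nonneg π x) fun h => hx (hπ.eq_zero x h.symm)

/-! ### The dual norm -/

section DualNorm

variable {E : Type*} [AddCommGroup E] [Module ℝ E] [TopologicalSpace E]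
  {π : Seminorm ℝ E}

theorem dualNorm_le {φ : StrongDual ℝ E} {C : ℝ} (hC : 0 ≤ C) (h : ∀ x, |φ x| ≤ C * π x) :
    dualNorm π φ ≤ C := by
  refine csSup_le ⟨0, 0, by simp, by simp⟩ ?_
  rintro r ⟨x, hx, rfl⟩
  exact (h x).trans (mul_le_of_le_one_right hC hx)

theorem IsNormingDualPair.bddAbove (hπ : IsNormingDualPair π) (φ : StrongDual ℝ E) :
    BddAbove {r : ℝ | ∃ x : E, π x ≤ 1 ∧ r = |φ x|} := by
  obtain ⟨C, hC⟩ := hπ.bounded φ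
  refine ⟨|C|, ?_⟩
  rintro r ⟨x, hx, rfl⟩
  calc |φ x| ≤ C * π x := hC x
    _ ≤ |C| * π x := by gcongr; exact le_abs_self C
    _ ≤ |C| := mul_le_of_le_one_right (abs_nonneg C) hx

theorem IsNormingDualPair.dualNorm_nonneg (hπ : IsNormingDualPair π) (φ : StrongDual ℝ E) :
    0 ≤ dualNorm π φ :=
  le_csSup (hπ.bddAbove φ) ⟨0, by simp, by simp⟩

theorem IsNormingDualPair.abs_apply_le (hπ : IsNormingDualPair π) (φ : StrongDual ℝ E) (x : E) :
    |φ x| ≤ dualNorm π φ * π x := by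
  rcases eq_or_ne x 0 with rfl | hx
  · simp
  have hpos := hπ.banach.pos hx
  have h : |φ ((π x)⁻¹ • x)| ≤ dualNorm π φ :=
    le_csSup (hπ.bddAbove φ) ⟨(π x)⁻¹ • x, by
      rw [map_smul_eq_mul, norm_inv, Real.norm_of_nonneg hpos.le, inv_mul_cancel₀ hpos.ne'], rfl⟩
  rw [map_smul, smul_eq_mul, abs_mul, abs_inv, abs_of_pos hpos, inv_mul_le_iff₀ hpos] at h
  linarith

/-- The norming property: `π x` is controlled by the values at `x` of the dual functionals. -/
theorem IsNormingDualPair.le_of_forall_abs_le (hπ : IsNormingDualPair π) {x : E} {C : ℝ}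
    (hC : 0 ≤ C) (h : ∀ φ : StrongDual ℝ E, |φ x| ≤ dualNorm π φ * C) : π x ≤ C := by
  refine (hπ.norming x).2 ?_
  rintro r ⟨φ, hφ, rfl⟩
  exact (h φ).trans (mul_le_of_le_one_left hC hφ)

theorem IsNormingDualPair.dualNorm_comp_le (hπ : IsNormingDualPair π) {S : E →L[ℝ] E} {C : ℝ}
    (hC : 0 ≤ C) (hS : ∀ x, π (S x) ≤ C * π x) (φ : StrongDual ℝ E) :
    dualNorm π (φ.comp S) ≤ C * dualNorm π φ := by
  have hφ := hπ.dualNorm_nonneg φ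
  refine dualNorm_le (mul_nonneg hC hφ) fun x => ?_
  calc |φ (S x)| ≤ dualNorm π φ * π (S x) := hπ.abs_apply_le φ _
    _ ≤ dualNorm π φ * (C * π x) := by gcongr; exact hS x
    _ = C * dualNorm π φ * π x := by ring

end DualNorm

/-! ### Completeness of the dual and uniform boundedness -/

section UniformBoundedness

variable {E : Type*} [AddCommGroup E] [Module ℝ E] [TopologicalSpace E]
  {π : Seminorm ℝ E}

/-- The dual of `E` without its topology, to be equipped with the dual norm. -/
def DualSpace (E : Type*) [AddCommGroup E] [Module ℝ E] [TopologicalSpace E] : Type _ :=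
  StrongDual ℝ E

noncomputable instance : AddCommGroup (DualSpace E) :=
  inferInstanceAs (AddCommGroup (StrongDual ℝ E))

noncomputable instance : Module ℝ (DualSpace E) :=
  inferInstanceAs (Module ℝ (StrongDual ℝ E))

/-- Evaluation at `x` as a linear form on the dual. -/
noncomputable def DualSpace.eval (x : E) : DualSpace E →ₗ[ℝ] ℝ where
  toFun φ := (show StrongDual ℝ E from φ) x
  map_add' _ _ := rfl
  map_smul' _ _ := rfl

theorem IsNormingDualPair.core (hπ : IsNormingDualPair π) :
    letI : Norm (DualSpace E) := ⟨dualNorm π⟩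
    NormedSpace.Core ℝ (DualSpace E) := by
  have hsmul_le : ∀ (c : ℝ) (φ : StrongDual ℝ E), dualNorm π (c • φ) ≤ |c| * dualNorm π φ := by
    intro c φ
    refine dualNorm_le (mul_nonneg (abs_nonneg c) (hπ.dualNorm_nonneg φ)) fun x => ?_
    have h := hπ.abs_apply_le φ x
    calc |c * φ x| = |c| * |φ x| := abs_mul _ _
      _ ≤ |c| * (dualNorm π φ * π x) := by gcongr
      _ = _ := by ring
  let : Norm (DualSpace E) := ⟨dualNorm π⟩
  refine { norm_nonneg := fun φ => hπ.dualNorm_nonneg φ, norm_smul := ?_, norm_triangle := ?_,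
           norm_eq_zero_iff := ?_ }
  · intro c φ
    refine le_antisymm (hsmul_le c φ) ?_
    rcases eq_or_ne c 0 with rfl | hc
    · simpa using hπ.dualNorm_nonneg _
    have h := hsmul_le c⁻¹ (c • (show StrongDual ℝ E from φ))
    rw [inv_smul_smul₀ hc, abs_inv, inv_mul_eq_div, le_div_iff₀ (abs_pos.2 hc)] at h
    rw [Real.norm_eq_abs, mul_comm]
    exact h
  · intro φ ψ
    refine dualNorm_le (add_nonneg (hπ.dualNorm_nonneg φ) (hπ.dualNorm_nonneg ψ)) fun x => ?_
    have h1 := hπ.abs_apply_le φ x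
    have h2 := hπ.abs_apply_le ψ x
    refine (abs_add_le ((show StrongDual ℝ E from φ) x) ((show StrongDual ℝ E from ψ) x)).trans ?_
    rw [add_mul]
    exact add_le_add h1 h2
  · intro φ
    refine ⟨fun h => ContinuousLinearMap.ext fun x => ?_, ?_⟩
    · have h1 := hπ.abs_apply_le φ x
      rw [show dualNorm π φ = 0 from h, zero_mul] at h1
      exact abs_nonpos_iff.1 h1
    · rintro rfl
      refine le_antisymm (dualNorm_le le_rfl fun x => ?_) (hπ.dualNorm_nonneg _)
      rw [zero_mul]
      exact (abs_zero (α := ℝ)).le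

/-- Uniform boundedness principle for the duality: a subset of `E` on which every `φ ∈ E'` is
bounded is `π`-bounded. -/
theorem IsNormingDualPair.exists_bound (hπ : IsNormingDualPair π) (S : Set E)
    (h : ∀ φ : StrongDual ℝ E, ∃ C : ℝ, ∀ x ∈ S, |φ x| ≤ C) :
    ∃ C : ℝ, 0 ≤ C ∧ ∀ x ∈ S, π x ≤ C := by
  let : Norm (DualSpace E) := ⟨dualNorm π⟩
  let : NormedAddCommGroup (DualSpace E) := .ofCore hπ.core
  let : NormedSpace ℝ (DualSpace E) := .ofCore hπ.core
  have hle : ∀ (φ : DualSpace E) (x : E), |DualSpace.eval x φ| ≤ ‖φ‖ * π x :=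
    fun φ x => hπ.abs_apply_le φ x
  have : CompleteSpace (DualSpace E) := by
    refine Metric.complete_of_cauchySeq_tendsto fun u hu => ?_
    have hu' := Metric.cauchySeq_iff.1 hu
    have hlim : ∀ x, ∃ l, Tendsto (fun n => DualSpace.eval x (u n)) atTop (𝓝 l) := by
      intro x
      refine cauchySeq_tendsto_of_complete (Metric.cauchySeq_iff.2 fun ε hε => ?_)
      obtain ⟨N, hN⟩ := hu' (ε / (π x + 1)) (by positivity)
      refine ⟨N, fun m hm n hn => ?_⟩
      have h1 := hN m hm n hn
      rw [dist_eq_norm, lt_div_iff₀ (by positivity)] at h1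
      rw [Real.dist_eq, ← map_sub]
      refine (hle _ x).trans_lt (lt_of_le_of_lt ?_ h1)
      gcongr
      linarith
    choose l hl using hlim
    let L : E →ₗ[ℝ] ℝ :=
      { toFun := l
        map_add' := fun x y => tendsto_nhds_unique (hl (x + y))
          (((hl x).add (hl y)).congr fun n => (map_add (show StrongDual ℝ E from u n) x y).symm)
        map_smul' := fun c x => tendsto_nhds_unique (hl (c • x))
          (((hl x).const_mul c).congr fun n => (map_smul (show StrongDual ℝ E from u n) c x).symm) }
    have happrox : ∀ ε > 0, ∃ N, ∀ n ≥ N, ∀ x, |l x - DualSpace.eval x (u n)| ≤ ε * π x := by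
      intro ε hε
      obtain ⟨N, hN⟩ := hu' ε hε
      refine ⟨N, fun n hn x => ?_⟩
      refine le_of_tendsto ((hl x).sub_const _).abs ?_
      filter_upwards [eventually_ge_atTop N] with m hm
      rw [← map_sub]
      refine (hle _ x).trans ?_
      gcongr
      rw [← dist_eq_norm]
      exact (hN m hm n hn).le
    -- The pointwise limit is a limit in the Banach dual, where `E'` is closed; this is what makes
    -- `E'` complete.
    have hcont : Continuous L := hπ.closed L fun ε hε => by
      obtain ⟨N, hN⟩ := happrox ε hε
      exact ⟨u N, hN N le_rfl⟩
    let ψ : DualSpace E := (⟨L, hcont⟩ : StrongDual ℝ E)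
    refine ⟨ψ, Metric.tendsto_atTop.2 fun ε hε => ?_⟩
    obtain ⟨N, hN⟩ := happrox (ε / 2) (half_pos hε)
    refine ⟨N, fun n hn => lt_of_le_of_lt ?_ (half_lt_self hε)⟩
    rw [dist_comm, dist_eq_norm]
    exact dualNorm_le (half_pos hε).le (hN n hn)
  -- Points of `E` act as functionals on the Banach space `E'`; the norming property recovers `π x`
  -- from the norm of evaluation at `x`.
  let g : S → DualSpace E →L[ℝ] ℝ := fun x =>
    (DualSpace.eval (x : E)).mkContinuous (π x) fun φ => by
      rw [Real.norm_eq_abs, mul_comm]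
      exact hle φ x
  obtain ⟨C, hC⟩ := banach_steinhaus (g := g) fun φ => by
    obtain ⟨C, hC⟩ := h φ
    exact ⟨C, fun x => hC x x.2⟩
  refine ⟨|C|, abs_nonneg C, fun x hx => hπ.le_of_forall_abs_le (abs_nonneg C) fun φ => ?_⟩
  calc |φ x| ≤ ‖g ⟨x, hx⟩‖ * dualNorm π φ :=
        (g ⟨x, hx⟩).le_opNorm (show DualSpace E from φ)
    _ ≤ |C| * dualNorm π φ := by
        gcongr
        · exact hπ.dualNorm_nonneg φ
        · exact (hC _).trans (le_abs_self C)
    _ = dualNorm π φ * |C| := mul_comm _ _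

/-- Uniform boundedness principle for families of operators, tested on a generating cone. -/
theorem IsNormingDualPair.exists_operator_bound (hπ : IsNormingDualPair π) {P : Set E}
    (hgen : ∀ φ : StrongDual ℝ E, ∃ φ₁ ∈ dualCone P, ∃ φ₂ ∈ dualCone P, φ = φ₁ - φ₂)
    {ι : Type*} (S : ι → E →L[ℝ] E) (c : ι → ℝ) (hc : ∀ i, 0 ≤ c i)
    (h : ∀ φ ∈ dualCone P, ∃ C : ℝ, ∀ i, c i * dualNorm π (φ.comp (S i)) ≤ C) :
    ∃ C : ℝ, 0 ≤ C ∧ ∀ i x, c i * π (S i x) ≤ C * π x := by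
  have hball : ∀ φ ∈ dualCone P, ∃ C : ℝ, ∀ i x, π x ≤ 1 → c i * |φ (S i x)| ≤ C := by
    intro φ hφ
    obtain ⟨C, hC⟩ := h φ hφ
    refine ⟨C, fun i x hx => le_trans ?_ (hC i)⟩
    gcongr
    · exact hc i
    · exact (hπ.abs_apply_le (φ.comp (S i)) x).trans
        (mul_le_of_le_one_right (hπ.dualNorm_nonneg _) hx)
  obtain ⟨C, hC0, hC⟩ := hπ.exists_bound {y | ∃ i x, π x ≤ 1 ∧ y = c i • S i x} fun φ => by
    obtain ⟨φ₁, h₁, φ₂, h₂, rfl⟩ := hgen φ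
    obtain ⟨C₁, hC₁⟩ := hball φ₁ h₁
    obtain ⟨C₂, hC₂⟩ := hball φ₂ h₂
    refine ⟨C₁ + C₂, ?_⟩
    rintro y ⟨i, x, hx, rfl⟩
    rw [map_smul, smul_eq_mul, abs_mul, abs_of_nonneg (hc i)]
    calc c i * |φ₁ (S i x) - φ₂ (S i x)| ≤ c i * (|φ₁ (S i x)| + |φ₂ (S i x)|) := by
          gcongr
          · exact hc i
          · exact abs_sub _ _
      _ ≤ C₁ + C₂ := by rw [mul_add]; exact add_le_add (hC₁ i x hx) (hC₂ i x hx)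
  refine ⟨C, hC0, fun i x => ?_⟩
  rcases eq_or_ne x 0 with rfl | hx
  · simp
  have hpos := hπ.banach.pos hx
  have h1 := hC (c i • S i ((π x)⁻¹ • x)) ⟨i, _, by
    rw [map_smul_eq_mul, norm_inv, Real.norm_of_nonneg hpos.le, inv_mul_cancel₀ hpos.ne'], rfl⟩
  rw [(S i).map_smul, map_smul_eq_mul, map_smul_eq_mul, norm_inv, Real.norm_of_nonneg hpos.le,
    Real.norm_of_nonneg (hc i), mul_left_comm, inv_mul_le_iff₀ hpos] at h1
  linarith

end UniformBoundedness
-- Metrizability of continuous images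
/-- A Hausdorff continuous image of a compact metrizable space is metrizable. -/
theorem metrizableSpace_of_surjective {X Y : Type*} [TopologicalSpace X] [CompactSpace X]
    [TopologicalSpace.MetrizableSpace X] [TopologicalSpace Y] [T2Space Y] {f : X → Y}
    (hf : Continuous f) (hsurj : Function.Surjective f) : TopologicalSpace.MetrizableSpace Y := by
  let := TopologicalSpace.metrizableSpaceMetric X
  have : CompactSpace Y := hsurj.compactSpace hf
  have hiso : Isometry fun g : C(Y, ℝ) => g.comp ⟨f, hf⟩ := by
    refine Isometry.of_dist_eq fun g h => le_antisymm ?_ ?_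
    · exact (ContinuousMap.dist_le dist_nonneg).2 fun x => ContinuousMap.dist_apply_le_dist (f x)
    · refine (ContinuousMap.dist_le dist_nonneg).2 fun y => ?_
      obtain ⟨x, rfl⟩ := hsurj y
      exact ContinuousMap.dist_apply_le_dist (f := g.comp ⟨f, hf⟩) (g := h.comp ⟨f, hf⟩) x
  -- `C(Y, ℝ)` embeds isometrically in `C(X, ℝ)`, which is separable because `X` is compact
  -- metrizable. A countable dense set in it will separate the points of `Y`.
  have : SecondCountableTopology C(Y, ℝ) := hiso.isUniformInducing.isInducing.secondCountableTopology
  have : Nonempty C(Y, ℝ) := ⟨0⟩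
  refine Metric.PiNatEmbed.TopologicalSpace.MetrizableSpace.of_countable_separating
    (fun n y => TopologicalSpace.denseSeq C(Y, ℝ) n y) (fun n => ContinuousMap.continuous _)
    fun x y hxy => ?_
  obtain ⟨g, hg0, hg1, -⟩ := exists_continuous_zero_one_of_isClosed (isClosed_singleton (x := x))
    (isClosed_singleton (x := y)) (by simpa using hxy)
  obtain ⟨n, hn⟩ := (TopologicalSpace.denseRange_denseSeq C(Y, ℝ)).exists_dist_lt g
    (ε := 1 / 2) (by norm_num)
  refine ⟨n, fun h => ?_⟩
  have h0 := (ContinuousMap.dist_apply_le_dist (f := g) x).trans_lt hn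
  have h1 := (ContinuousMap.dist_apply_le_dist (f := g) y).trans_lt hn
  rw [hg0 rfl, Real.dist_eq, abs_lt] at h0
  rw [hg1 rfl, Real.dist_eq, abs_lt] at h1
  simp only [Pi.zero_apply, Pi.one_apply] at h0 h1
  linarith [h0.1, h1.2]

/-! ### Weak integrals of continuous curves -/

section WeakIntegral

variable {E : Type*} [AddCommGroup E] [Module ℝ E] [TopologicalSpace E]
  [IsTopologicalAddGroup E] [ContinuousSMul ℝ E]

/-- A continuous curve on a compact interval has a weak integral. -/
theorem CompactConvexClosures.exists_integral [T2Space E] (hE : CompactConvexClosures E)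
    {f : ℝ → E} {a : ℝ} (ha : 0 ≤ a) (hf : ContinuousOn f (Icc 0 a)) :
    ∃ y : E, ∀ φ : StrongDual ℝ E, φ y = ∫ t in 0..a, φ (f t) := by
  rcases ha.eq_or_lt with rfl | ha
  · exact ⟨0, by simp⟩
  have hcomp : IsCompact (f '' Icc 0 a) := isCompact_Icc.image_of_continuousOn hf
  have hmetr : TopologicalSpace.MetrizableSpace (f '' Icc 0 a) :=
    metrizableSpace_of_surjective (f := (mapsTo_image f (Icc 0 a)).restrict)
      (hf.mapsToRestrict (mapsTo_image f (Icc 0 a))) (surjective_mapsTo_image_restrict f (Icc 0 a))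
  have hK := hE _ hcomp hmetr
  set K := closure (convexHull ℝ (f '' Icc 0 a)) with hKdef
  have hKconv : Convex ℝ K := (convex_convexHull ℝ _).closure
  have hint : ∀ φ : StrongDual ℝ E, IntegrableOn (fun t => φ (f t)) (Ioc 0 a) := fun φ =>
    ((φ.continuous.comp_continuousOn hf).integrableOn_Icc).mono_set Ioc_subset_Icc_self
  -- By compactness of `K` it is enough to match finitely many functionals at once. These map `K` to
  -- a compact convex set in a finite-dimensional space, which contains the average of the curve.
  obtain ⟨y, -, hy⟩ := hK.inter_iInter_nonempty
    (fun φ : StrongDual ℝ E => {y : E | φ y = ⨍ t in Ioc 0 a, φ (f t)})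
    (fun φ => isClosed_eq φ.continuous continuous_const) fun u => by
      let Φ : E →L[ℝ] (u → ℝ) := ContinuousLinearMap.pi fun φ => (φ : StrongDual ℝ E)
      have hΦ : IntegrableOn (fun t => Φ (f t)) (Ioc 0 a) :=
        Integrable.of_eval fun φ => hint φ
      have hmem : (⨍ t in Ioc 0 a, Φ (f t)) ∈ Φ '' K := by
        refine (hKconv.linear_image Φ.toLinearMap).set_average_mem (hK.image Φ.continuous).isClosed
          (by simp [ha]) (by simp) ?_ hΦ
        filter_upwards [ae_restrict_mem measurableSet_Ioc] with t ht
        exact mem_image_of_mem _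
          (subset_closure (subset_convexHull ℝ _ (mem_image_of_mem f (Ioc_subset_Icc_self ht))))
      obtain ⟨y, hyK, hy⟩ := hmem
      refine ⟨y, hyK, mem_iInter₂.2 fun φ hφ => ?_⟩
      have h := congrFun hy ⟨φ, hφ⟩
      rw [setAverage_eq, Pi.smul_apply, eval_integral (Integrable.eval hΦ)] at h
      rw [mem_ofPred, setAverage_eq]
      exact h
  refine ⟨a • y, fun φ => ?_⟩
  have h : φ y = ⨍ t in Ioc 0 a, φ (f t) := mem_iInter.1 hy φ
  rw [map_smul, h, setAverage_eq, intervalIntegral.integral_of_le ha.le]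
  simp [ha.le, ha.ne']

/-- Weak means over shrinking intervals converge in the locally convex topology. -/
theorem tendsto_inv_smul_of_weak_integral [LocallyConvexSpace ℝ E] {f g : ℝ → E}
    (hf : ContinuousOn f (Ici 0))
    (hg : ∀ h > 0, ∀ φ : StrongDual ℝ E, φ (g h) = ∫ t in 0..h, φ (f t)) :
    Tendsto (fun h : ℝ => h⁻¹ • g h) (𝓝[>] 0) (𝓝 (f 0)) := by
  intro U hU
  obtain ⟨s, ⟨hs, hconv⟩, hsU⟩ := (LocallyConvexSpace.convex_basis (𝕜 := ℝ) (f 0)).mem_iff.1 hU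
  have hev : ∀ᶠ t in 𝓝[≥] (0 : ℝ), f t ∈ interior s :=
    (hf 0 self_mem_Ici).eventually (isOpen_interior.mem_nhds (mem_interior_iff_mem_nhds.2 hs))
  obtain ⟨δ, hδ, hsub⟩ := mem_nhdsGE_iff_exists_Ico_subset.1 hev
  rw [mem_map]
  filter_upwards [Ioo_mem_nhdsGT hδ] with h ⟨h0, hlt⟩
  refine hsU (interior_subset ?_)
  by_contra hnot
  -- A mean outside the open convex set would be strictly separated from all the values being
  -- averaged; integrating that strict inequality gives `0 < 0`.
  obtain ⟨φ, hφ⟩ := geometric_hahn_banach_open_point hconv.interior isOpen_interior hnot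
  have hcont : IntervalIntegrable (fun t => φ (f t)) volume 0 h := by
    refine ContinuousOn.intervalIntegrable_of_Icc h0.le (φ.continuous.comp_continuousOn ?_)
    exact hf.mono Icc_subset_Ici_self
  have hpos : 0 < ∫ t in 0..h, (φ (h⁻¹ • g h) - φ (f t)) := by
    refine intervalIntegral.intervalIntegral_pos_of_pos_on
      (intervalIntegrable_const.sub hcont) (fun t ht => sub_pos.2 (hφ _ ?_)) h0
    exact hsub ⟨ht.1.le, ht.2.trans hlt⟩
  rw [intervalIntegral.integral_sub intervalIntegrable_const hcont, ← hg h h0, map_smul,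
    intervalIntegral.integral_const, sub_zero, smul_smul, mul_inv_cancel₀ h0.ne', one_smul,
    sub_self] at hpos
  exact lt_irrefl _ hpos

end WeakIntegral
-- The Datko–Pazy argument
theorem sub_mul_le_of_forall_le {f : ℝ → ℝ} {a b c K : ℝ} (ha : 0 ≤ a) (hK : 0 ≤ K)
    (hc : 0 ≤ c) (h : ∀ s ∈ Ioo a b, c ≤ K * f s)
    (hf : ∫⁻ t in Ioi (0 : ℝ), ENNReal.ofReal (f t) < ∞) :
    (b - a) * c ≤ K * (∫⁻ t in Ioi (0 : ℝ), ENNReal.ofReal (f t)).toReal := by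
  have h1 : ENNReal.ofReal c * ENNReal.ofReal (b - a) ≤
      ENNReal.ofReal K * ∫⁻ t in Ioi (0 : ℝ), ENNReal.ofReal (f t) := by
    rw [← Real.volume_Ioo, ← setLIntegral_const, ← lintegral_const_mul' _ _ ENNReal.ofReal_ne_top]
    calc ∫⁻ _ in Ioo a b, ENNReal.ofReal c
        ≤ ∫⁻ t in Ioo a b, ENNReal.ofReal K * ENNReal.ofReal (f t) := by
          refine setLIntegral_mono' measurableSet_Ioo fun t ht => ?_
          rw [← ENNReal.ofReal_mul hK]
          exact ENNReal.ofReal_le_ofReal (h t ht)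
      _ ≤ _ := lintegral_mono_set fun t ht => ha.trans_lt ht.1
  rw [← ENNReal.ofReal_mul hc, mul_comm c] at h1
  have h2 := (ENNReal.ofReal_le_iff_le_toReal (ENNReal.mul_ne_top ENNReal.ofReal_ne_top hf.ne)).1 h1
  rwa [ENNReal.toReal_mul, ENNReal.toReal_ofReal hK] at h2

section Stability

variable {E : Type*} [AddCommGroup E] [Module ℝ E] [TopologicalSpace E]
  {π : Seminorm ℝ E} {T : ℝ → E →L[ℝ] E}

theorem IsCbSemigroup.add_apply (hT : IsCbSemigroup T) {t s : ℝ} (ht : 0 ≤ t) (hs : 0 ≤ s)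
    (x : E) : T (t + s) x = T t (T s x) := by
  rw [hT.add t ht s hs]
  rfl

/-- A bounded semigroup one of whose operators is a strict contraction decays exponentially. -/
theorem IsCbSemigroup.isExpStable_of_half (hT : IsCbSemigroup T) {K t₀ : ℝ} (hK : 0 ≤ K)
    (hbound : ∀ t ≥ 0, ∀ x, π (T t x) ≤ K * π x) (ht₀ : 0 < t₀)
    (hhalf : ∀ x, π (T t₀ x) ≤ 1 / 2 * π x) : IsExpStable π T := by
  have hpow : ∀ (n : ℕ) (x : E), π (T (n * t₀) x) ≤ (1 / 2) ^ n * π x := by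
    intro n
    induction n with
    | zero => intro x; simp [hT.zero]
    | succ n ih =>
      intro x
      rw [Nat.cast_succ, add_mul, one_mul, hT.add_apply (by positivity) ht₀.le]
      calc π (T (n * t₀) (T t₀ x)) ≤ (1 / 2) ^ n * π (T t₀ x) := ih _
        _ ≤ (1 / 2) ^ n * (1 / 2 * π x) := by gcongr; exact hhalf x
        _ = _ := by ring
  -- Rounding `t / t₀` down costs at most one halving, hence the factor `2`; `K + 1` keeps the
  -- constant positive.
  refine ⟨2 * (K + 1), by positivity, Real.log 2 / t₀, div_pos (Real.log_pos one_lt_two) ht₀,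
    fun t ht x => ?_⟩
  set n := ⌊t / t₀⌋₊ with hn
  have hle : n * t₀ ≤ t := (le_div_iff₀ ht₀).1 (Nat.floor_le (by positivity))
  have hlt : t / t₀ < n + 1 := Nat.lt_floor_add_one _
  have hexp : (1 / 2 : ℝ) ^ n ≤ 2 * Real.exp (-(Real.log 2 / t₀) * t) := by
    have hlog := Real.log_pos one_lt_two
    calc (1 / 2 : ℝ) ^ n = Real.exp (-(n * Real.log 2)) := by
          rw [Real.exp_neg, Real.exp_nat_mul, Real.exp_log two_pos, one_div, inv_pow]
      _ ≤ Real.exp (Real.log 2 + -(Real.log 2 / t₀) * t) := by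
          gcongr
          have : Real.log 2 / t₀ * t = Real.log 2 * (t / t₀) := by ring
          nlinarith
      _ = _ := by rw [Real.exp_add, Real.exp_log two_pos]
  have hsplit : T t x = T (n * t₀) (T (t - n * t₀) x) := by
    rw [← hT.add_apply (by positivity) (sub_nonneg.2 hle), add_sub_cancel]
  rw [hsplit]
  calc π (T (n * t₀) (T (t - n * t₀) x)) ≤ (1 / 2) ^ n * π (T (t - n * t₀) x) := hpow n _
    _ ≤ (2 * Real.exp (-(Real.log 2 / t₀) * t)) * ((K + 1) * π x) := by
        gcongr
        refine (hbound _ (sub_nonneg.2 hle) x).trans ?_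
        gcongr
        linarith
    _ = _ := by ring

/-- The Datko–Pazy theorem for the dual semigroup. -/
theorem IsL1Stable.isExpStable (hπ : IsNormingDualPair π) {P : Set E}
    (hgen : ∀ φ : StrongDual ℝ E, ∃ φ₁ ∈ dualCone P, ∃ φ₂ ∈ dualCone P, φ = φ₁ - φ₂)
    (hT : IsCbSemigroup T) (hcomp : IsCompatible π P T) (hL : IsL1Stable π P T) :
    IsExpStable π T := by
  -- Since `T'(t) φ = T'(t - s) T'(s) φ`, the dual norm at time `t` is controlled by the one at any
  -- earlier time `s`.
  have hle : ∀ {C t s : ℝ}, 0 ≤ C → 0 ≤ s → s ≤ t → (∀ x, π (T (t - s) x) ≤ C * π x) →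
      ∀ φ : StrongDual ℝ E, dualNorm π (φ.comp (T t)) ≤ C * dualNorm π (φ.comp (T s)) := by
    intro C t s hC hs hst h φ
    have := hπ.dualNorm_comp_le hC h (φ.comp (T s))
    rwa [ContinuousLinearMap.comp_assoc, ← hT.add s hs _ (sub_nonneg.2 hst),
      add_sub_cancel] at this
  obtain ⟨M, hM0, hM⟩ := hπ.exists_operator_bound hgen (fun t : Icc (0 : ℝ) 1 => T t)
    (fun _ => 1) (fun _ => zero_le_one) fun φ hφ => by
      obtain ⟨C, hC⟩ := isCompact_Icc.bddAbove_image
        ((hcomp φ hφ).mono fun t (ht : t ∈ Icc (0 : ℝ) 1) => ht.1)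
      exact ⟨C, fun t => by rw [one_mul]; exact hC (mem_image_of_mem _ t.2)⟩
  have hM' : ∀ t, 0 ≤ t → t ≤ 1 → ∀ x, π (T t x) ≤ M * π x := fun t h0 h1 x => by
    simpa using hM ⟨t, h0, h1⟩ x
  obtain ⟨K, hK0, hK⟩ := hπ.exists_operator_bound hgen (fun t : Ici (0 : ℝ) => T t)
    (fun _ => 1) (fun _ => zero_le_one) fun φ hφ => by
      set J := (∫⁻ t in Ioi (0 : ℝ), ENNReal.ofReal (dualNorm π (φ.comp (T t)))).toReal
      have hφ0 := hπ.dualNorm_nonneg φ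
      refine ⟨M * dualNorm π φ + M * J, fun ⟨t, ht⟩ => ?_⟩
      rw [one_mul]
      rcases le_total t 1 with h1 | h1
      · exact (hπ.dualNorm_comp_le hM0 (hM' t ht h1) φ).trans
          (le_add_of_nonneg_right (by positivity))
      -- For `t ≥ 1`, average over the preceding unit interval, where the local bound `M` applies.
      · have h := sub_mul_le_of_forall_le (a := t - 1) (b := t) (sub_nonneg.2 h1) hM0
          (hπ.dualNorm_nonneg (φ.comp (T t)))
          (fun s hs => hle hM0 (by linarith [hs.1]) hs.2.le
            (hM' _ (by linarith [hs.2]) (by linarith [hs.1])) φ) (hL φ hφ)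
        rw [sub_sub_cancel, one_mul] at h
        exact h.trans (le_add_of_nonneg_left (by positivity))
  have hK' : ∀ t ≥ 0, ∀ x, π (T t x) ≤ K * π x := fun t h0 x => by simpa using hK ⟨t, h0⟩ x
  -- Averaging over all of `(0, t)` bounds `t T(t)` by `D`; at `t₀ = 2 D + 1` the norm is then at
  -- most `D / (2 D + 1) ≤ 1/2`.
  obtain ⟨D, hD0, hD⟩ := hπ.exists_operator_bound hgen (fun t : Ici (0 : ℝ) => T t)
    (fun t => t) (fun t => t.2) fun φ hφ => by
      refine ⟨K * (∫⁻ t in Ioi (0 : ℝ), ENNReal.ofReal (dualNorm π (φ.comp (T t)))).toReal,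
        fun ⟨t, ht⟩ => ?_⟩
      have h := sub_mul_le_of_forall_le (a := 0) (b := t) le_rfl hK0
        (hπ.dualNorm_nonneg (φ.comp (T t)))
        (fun s hs => hle hK0 hs.1.le hs.2.le (hK' _ (sub_nonneg.2 hs.2.le)) φ) (hL φ hφ)
      rwa [sub_zero] at h
  refine hT.isExpStable_of_half hK0 hK' (t₀ := 2 * D + 1) (by positivity) fun x => ?_
  have h := hD ⟨2 * D + 1, mem_Ici.2 (by positivity)⟩ x
  have h0 := apply_nonneg π (T (2 * D + 1) x)
  have h1 := apply_nonneg π x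
  simp only at h
  nlinarith [mul_nonneg hD0 h0]

end Stability
-- Orbit integrals, the generator and its inverse
section Orbits

variable {E : Type*} [AddCommGroup E] [Module ℝ E] [TopologicalSpace E]
  {π : Seminorm ℝ E} {T : ℝ → E →L[ℝ] E}

theorem IsCbSemigroup.continuousOn_apply (hT : IsCbSemigroup T) (φ : StrongDual ℝ E) (x : E) :
    ContinuousOn (fun t => φ (T t x)) (Ici 0) :=
  φ.continuous.comp_continuousOn (hT.continuousOn x)

theorem IsCbSemigroup.intervalIntegrable_apply (hT : IsCbSemigroup T) (φ : StrongDual ℝ E) (x : E)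
    {a : ℝ} (ha : 0 ≤ a) : IntervalIntegrable (fun t => φ (T t x)) volume 0 a :=
  ((hT.continuousOn_apply φ x).mono Icc_subset_Ici_self).intervalIntegrable_of_Icc ha

theorem abs_apply_orbit_le (hπ : IsNormingDualPair π) {M ε : ℝ}
    (hexp : ∀ t ≥ 0, ∀ x, π (T t x) ≤ M * Real.exp (-ε * t) * π x) (φ : StrongDual ℝ E) (x : E)
    {t : ℝ} (ht : 0 ≤ t) :
    |φ (T t x)| ≤ dualNorm π φ * (M * π x) * Real.exp (-ε * t) := by
  have h0 := hπ.dualNorm_nonneg φ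
  calc |φ (T t x)| ≤ dualNorm π φ * π (T t x) := hπ.abs_apply_le φ _
    _ ≤ dualNorm π φ * (M * Real.exp (-ε * t) * π x) := by gcongr; exact hexp t ht x
    _ = _ := by ring

theorem IsCbSemigroup.integrableOn_apply (hT : IsCbSemigroup T) (hπ : IsNormingDualPair π)
    {M ε : ℝ} (hε : 0 < ε) (hexp : ∀ t ≥ 0, ∀ x, π (T t x) ≤ M * Real.exp (-ε * t) * π x)
    (φ : StrongDual ℝ E) (x : E) {a : ℝ} (ha : 0 ≤ a) :
    IntegrableOn (fun t => φ (T t x)) (Ioi a) := by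
  refine Integrable.mono' ((integrableOn_exp_mul_Ioi (neg_lt_zero.2 hε) a).const_mul
    (dualNorm π φ * (M * π x))) ?_ ?_
  · exact ((hT.continuousOn_apply φ x).mono
      (Ioi_subset_Ici ha)).aestronglyMeasurable measurableSet_Ioi
  · filter_upwards [ae_restrict_mem measurableSet_Ioi] with t ht
    exact abs_apply_orbit_le hπ hexp φ x (ha.trans (le_of_lt ht))

theorem abs_integral_orbit_le (hπ : IsNormingDualPair π)
    {M ε : ℝ} (hε : 0 < ε) (hexp : ∀ t ≥ 0, ∀ x, π (T t x) ≤ M * Real.exp (-ε * t) * π x)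
    (φ : StrongDual ℝ E) (x : E) {a : ℝ} (ha : 0 ≤ a) :
    |∫ t in Ioi a, φ (T t x)| ≤ dualNorm π φ * (M * π x * Real.exp (-ε * a) / ε) := by
  have h := norm_integral_le_of_norm_le (f := fun t => φ (T t x)) (μ := volume.restrict (Ioi a))
    ((integrableOn_exp_mul_Ioi (neg_lt_zero.2 hε) a).const_mul (dualNorm π φ * (M * π x))) (by
      filter_upwards [ae_restrict_mem measurableSet_Ioi] with t ht
      exact abs_apply_orbit_le hπ hexp φ x (ha.trans (le_of_lt ht)))
  rw [integral_const_mul, integral_exp_mul_Ioi (neg_lt_zero.2 hε), neg_div_neg_eq] at h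
  exact h.trans_eq (by ring)

variable [IsTopologicalAddGroup E] [ContinuousSMul ℝ E]

/-- Shifting the integral by `h` shows that `y - T(h) y` is the weak integral of the orbit over `[0,
h]`, whose means tend to `x`. -/
theorem IsCbSemigroup.tendsto_sub_of_integral_Ioi [LocallyConvexSpace ℝ E]
    (hπ : IsNormingDualPair π) (hT : IsCbSemigroup T) {M ε : ℝ} (hε : 0 < ε)
    (hexp : ∀ t ≥ 0, ∀ x, π (T t x) ≤ M * Real.exp (-ε * t) * π x) {x y : E}
    (hy : ∀ φ : StrongDual ℝ E, φ y = ∫ t in Ioi (0 : ℝ), φ (T t x)) :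
    Tendsto (fun h : ℝ => h⁻¹ • (T h y - y)) (𝓝[>] 0) (𝓝 (-x)) := by
  have h := tendsto_inv_smul_of_weak_integral (f := fun t => T t x) (g := fun h => y - T h y)
    (hT.continuousOn x) fun h hh φ => by
      have hshift : φ (T h y) = ∫ t in Ioi h, φ (T t x) := by
        calc φ (T h y) = ∫ t in Ioi (0 : ℝ), φ (T h (T t x)) := hy (φ.comp (T h))
          _ = ∫ t in Ioi (0 : ℝ), φ (T (t + h) x) := by
              refine setIntegral_congr_fun measurableSet_Ioi fun t ht => ?_
              simp only [add_comm t h, hT.add_apply hh.le (le_of_lt ht)]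
          _ = ∫ t in Ioi h, φ (T t x) := by
              have := (measurePreserving_add_right (volume : Measure ℝ) h).setIntegral_preimage_emb
                (measurableEmbedding_addRight h) (fun t => φ (T t x)) (Ioi h)
              simpa using this
      rw [map_sub, hshift, hy, intervalIntegral.integral_Ioi_sub_Ioi
        (hT.integrableOn_apply hπ hε hexp φ x le_rfl) hh.le]
  simp only [hT.zero, ContinuousLinearMap.id_apply] at h
  refine h.neg.congr fun t => ?_
  rw [← smul_neg, neg_sub]

variable [T2Space E]

/-- The weak integral of an exponentially decaying orbit over the half-line. -/
theorem IsCbSemigroup.exists_integral_Ioi (hE : CompactConvexClosures E)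
    (hπ : IsNormingDualPair π) (hT : IsCbSemigroup T) {M ε : ℝ} (hM : 0 < M) (hε : 0 < ε)
    (hexp : ∀ t ≥ 0, ∀ x, π (T t x) ≤ M * Real.exp (-ε * t) * π x) (x : E) :
    ∃ y : E, ∀ φ : StrongDual ℝ E, φ y = ∫ t in Ioi (0 : ℝ), φ (T t x) := by
  choose u hu using fun n : ℕ => hE.exists_integral (Nat.cast_nonneg (α := ℝ) n)
    ((hT.continuousOn x).mono Icc_subset_Ici_self)
  set C := M * π x / ε with hC
  have hC0 : 0 ≤ C := by positivity
  have htail : ∀ (n : ℕ) (φ : StrongDual ℝ E),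
      |(∫ t in Ioi (0 : ℝ), φ (T t x)) - φ (u n)| ≤ dualNorm π φ * (C * Real.exp (-ε * n)) := by
    intro n φ
    rw [hu n φ, ← intervalIntegral.integral_interval_add_Ioi'
      (hT.intervalIntegrable_apply φ x n.cast_nonneg)
      (hT.integrableOn_apply hπ hε hexp φ x n.cast_nonneg), add_sub_cancel_left]
    exact (abs_integral_orbit_le hπ hε hexp φ x n.cast_nonneg).trans_eq (by rw [hC]; ring)
  have hexp0 : Tendsto (fun n : ℕ => C * Real.exp (-ε * n)) atTop (𝓝 0) := by
    have : Tendsto (fun n : ℕ => -ε * (n : ℝ)) atTop atBot :=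
      tendsto_natCast_atTop_atTop.const_mul_atTop_of_neg (neg_lt_zero.2 hε)
    simpa using (Real.tendsto_exp_atBot.comp this).const_mul C
  -- The tail bound is uniform over dual functionals of norm at most one, so the truncated integrals
  -- are `π`-Cauchy.
  obtain ⟨y, hy⟩ := hπ.banach.complete u fun δ hδ => by
    obtain ⟨N, hN⟩ := eventually_atTop.1 (hexp0.eventually (gt_mem_nhds (half_pos hδ)))
    refine ⟨N, fun m hm n hn => ?_⟩
    refine (hπ.le_of_forall_abs_le (C := C * Real.exp (-ε * m) + C * Real.exp (-ε * n))
      (by positivity) fun φ => ?_).trans_lt (by linarith [hN m hm, hN n hn])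
    have hm := abs_le.1 (htail m φ)
    have hn := abs_le.1 (htail n φ)
    rw [map_sub, mul_add, abs_le]
    constructor <;> linarith [hm.1, hm.2, hn.1, hn.2]
  refine ⟨y, fun φ => tendsto_nhds_unique (f := fun n => φ (u n)) (l := atTop) ?_ ?_⟩
  · rw [tendsto_iff_dist_tendsto_zero]
    refine squeeze_zero (fun _ => dist_nonneg) (fun n => ?_)
      (by simpa using hy.const_mul (dualNorm π φ))
    rw [Real.dist_eq, ← map_sub]
    exact hπ.abs_apply_le φ _
  · rw [tendsto_iff_dist_tendsto_zero]
    refine squeeze_zero (fun _ => dist_nonneg) (fun n => ?_)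
      (by simpa only [mul_zero] using hexp0.const_mul (dualNorm π φ))
    rw [dist_comm, Real.dist_eq]
    exact htail n φ

theorem mem_generator_of_tendsto {x y : E}
    (h : Tendsto (fun t : ℝ => t⁻¹ • (T t x - x)) (𝓝[>] 0) (𝓝 y)) :
    ∃ hx : x ∈ (generator T).domain, generator T ⟨x, hx⟩ = y :=
  ⟨⟨y, h⟩, tendsto_nhds_unique (generator_tendsto T ⟨x, ⟨y, h⟩⟩) h⟩

/-- The generator only supplies right derivatives of orbits; with continuity these suffice for the
fundamental theorem of calculus. -/
theorem IsCbSemigroup.integral_generator (hT : IsCbSemigroup T) (φ : StrongDual ℝ E)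
    (x : (generator T).domain) {a : ℝ} (ha : 0 ≤ a) :
    ∫ t in 0..a, φ (T t (generator T x)) = φ (T a x) - φ x := by
  have h := intervalIntegral.integral_eq_sub_of_hasDeriv_right_of_le ha
    ((hT.continuousOn_apply φ x).mono Icc_subset_Ici_self) (fun t ht => ?_)
    (hT.intervalIntegrable_apply φ (generator T x) ha)
  · rw [h, hT.zero]
    rfl
  rw [hasDerivWithinAt_iff_tendsto_slope' self_notMem_Ioi]
  have hshift : Tendsto (fun s => s - t) (𝓝[>] t) (𝓝[>] 0) := by
    refine tendsto_nhdsWithin_iff.2 ⟨?_, ?_⟩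
    · have : Tendsto (fun s => s - t) (𝓝 t) (𝓝 (t - t)) := (continuous_sub_right t).tendsto t
      rw [sub_self] at this
      exact this.mono_left nhdsWithin_le_nhds
    · filter_upwards [self_mem_nhdsWithin] with s hs
      exact mem_Ioi.2 (sub_pos.2 (mem_Ioi.1 hs))
  refine (((φ.comp (T t)).continuous.tendsto _).comp
    ((generator_tendsto T x).comp hshift)).congr' ?_
  filter_upwards [self_mem_nhdsWithin] with s hs
  have hadd := hT.add_apply ht.1.le (sub_nonneg.2 (le_of_lt hs)) (x : E)
  rw [add_sub_cancel] at hadd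
  simp [slope_def_module, hadd]

/-- An exponentially stable positive semigroup has a generator with a negative bounded inverse. -/
theorem IsExpStable.hasNegPosBoundedInverse [LocallyConvexSpace ℝ E]
    (hE : CompactConvexClosures E) (hπ : IsNormingDualPair π) (P : ProperCone ℝ E)
    (hT : IsCbSemigroup T) (hpos : IsPositive (P : Set E) T) (h : IsExpStable π T) :
    HasNegPosBoundedInverse π (P : Set E) (generator T) := by
  obtain ⟨M, hM, ε, hε, hexp⟩ := h
  choose R hR using hT.exists_integral_Ioi hE hπ hM hε hexp
  have hint := fun φ x => hT.integrableOn_apply hπ hε hexp φ x le_rfl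
  have hext : ∀ {x y : E}, (∀ φ : StrongDual ℝ E, φ x = φ y) → x = y := fun h =>
    (SeparatingDual.eq_iff_forall_dual_eq (R := ℝ)).2 h
  let B : E →ₗ[ℝ] E :=
    { toFun := fun x => -R x
      map_add' := fun x y => hext fun φ => by
        simp only [map_neg, map_add, hR, integral_add (hint φ x) (hint φ y)]
        ring
      map_smul' := fun c x => hext fun φ => by
        simp only [map_neg, map_smul, hR, RingHom.id_apply, integral_const_mul, smul_eq_mul]
        ring }
  refine ⟨B, fun x => ?_, fun x => hext fun φ => ?_, ⟨M / ε, fun x => ?_⟩, fun x hx => ?_⟩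
  · refine mem_generator_of_tendsto ?_
    have h := (hT.tendsto_sub_of_integral_Ioi hπ hε hexp (hR x)).neg
    rw [neg_neg] at h
    refine h.congr fun t => ?_
    change _ = t⁻¹ • (T t (-R x) - -R x)
    rw [map_neg, ← smul_neg]
    congr 1
    abel
  · change φ (-R (generator T x)) = φ x
    rw [map_neg, hR]
    have h1 := intervalIntegral_tendsto_integral_Ioi 0 (hint φ (generator T x)) tendsto_id
    have h2 : Tendsto (fun a => φ (T a x) - φ x) atTop (𝓝 (0 - φ x)) := by
      refine Tendsto.sub_const (squeeze_zero_norm' (a := fun t =>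
        dualNorm π φ * (M * π x) * Real.exp (-ε * t)) ?_ ?_) _
      · filter_upwards [eventually_ge_atTop 0] with t ht
        exact abs_apply_orbit_le hπ hexp φ x ht
      · have : Tendsto (fun t : ℝ => -ε * t) atTop atBot :=
          tendsto_id.const_mul_atTop_of_neg (neg_lt_zero.2 hε)
        simpa using (Real.tendsto_exp_atBot.comp this).const_mul (dualNorm π φ * (M * π x))
    have h3 := tendsto_nhds_unique h1 (h2.congr' (by
      filter_upwards [eventually_ge_atTop 0] with a ha
      exact (hT.integral_generator φ x ha).symm))
    rw [h3]
    ring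
  · change π (-R x) ≤ _
    rw [map_neg_eq_map]
    refine hπ.le_of_forall_abs_le (by positivity) fun φ => ?_
    rw [hR]
    refine (abs_integral_orbit_le hπ hε hexp φ x le_rfl).trans_eq ?_
    rw [mul_zero, Real.exp_zero]
    ring
  · change - -R x ∈ (P : Set E)
    rw [neg_neg]
    by_contra hnot
    -- The cone is closed and convex, so a point outside it is detected by a positive functional,
    -- yet such a functional has a nonnegative integral along the orbit.
    obtain ⟨φ, hφ, hneg⟩ := P.hyperplane_separation_point hnot
    rw [hR] at hneg
    exact hneg.not_ge (setIntegral_nonneg measurableSet_Ioi fun t ht =>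
      hφ _ (hpos t (le_of_lt ht) x hx))

/-- `φ x` serves as a Lyapunov bound: it dominates every partial integral, because `φ (T a x) ≥ 0`.
-/
theorem lintegral_lt_top_of_generator_eq_neg {P : Set E} (hT : IsCbSemigroup T)
    (hpos : IsPositive P T) {x : (generator T).domain} (hx : (x : E) ∈ P) {z : E} (hz : z ∈ P)
    (hxz : generator T x = -z) {φ : StrongDual ℝ E} (hφ : φ ∈ dualCone P) :
    ∫⁻ t in Ioi (0 : ℝ), ENNReal.ofReal (φ (T t z)) < ∞ := by
  have hnn : ∀ t ≥ 0, 0 ≤ φ (T t z) := fun t ht => hφ _ (hpos t ht z hz)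
  have hbound : ∀ a : ℝ, 0 ≤ a → ∫ t in 0..a, ‖φ (T t z)‖ ≤ φ x := by
    intro a ha
    have h := hT.integral_generator φ x ha
    rw [hxz] at h
    simp only [map_neg, intervalIntegral.integral_neg] at h
    have h1 : ∫ t in 0..a, ‖φ (T t z)‖ = ∫ t in 0..a, φ (T t z) := by
      refine intervalIntegral.integral_congr fun t ht => ?_
      rw [uIcc_of_le ha] at ht
      exact Real.norm_of_nonneg (hnn t ht.1)
    linarith [hφ _ (hpos a ha x hx)]
  have hI : IntegrableOn (fun t => φ (T t z)) (Ioi 0) :=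
    integrableOn_Ioi_of_intervalIntegral_norm_bounded (l := atTop) (b := fun a : ℝ => a) (φ x) 0
      (fun a => by
        rcases le_total 0 a with ha | ha
        · exact ((intervalIntegrable_iff_integrableOn_Ioc_of_le ha).1
            (hT.intervalIntegrable_apply φ z ha))
        · simp [Ioc_eq_empty_of_le ha])
      tendsto_id (by filter_upwards [eventually_ge_atTop 0] with a ha using hbound a ha)
  rw [← ofReal_integral_eq_lintegral_ofReal hI]
  · exact ENNReal.ofReal_lt_top
  · filter_upwards [ae_restrict_mem measurableSet_Ioi] with t ht using hnn t (le_of_lt ht)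

end Orbits
end LyapunovPair

theorem mainTheorem2 {E : Type*} [AddCommGroup E] [Module ℝ E] [TopologicalSpace E]
    [IsTopologicalAddGroup E] [ContinuousSMul ℝ E] [LocallyConvexSpace ℝ E] [T2Space E]
    (hE : LyapunovPair.CompactConvexClosures E)
    (π : Seminorm ℝ E) (hπ : LyapunovPair.IsNormingDualPair π)
    (P : ProperCone ℝ E) (hP : ∀ x ∈ P, -x ∈ P → x = 0)
    (hgen : ∀ φ : StrongDual ℝ E, ∃ φ₁ ∈ LyapunovPair.dualCone (P : Set E),
      ∃ φ₂ ∈ LyapunovPair.dualCone (P : Set E), φ = φ₁ - φ₂)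
    (T : ℝ → E →L[ℝ] E) (hT : LyapunovPair.IsCbSemigroup T)
    (hTpos : LyapunovPair.IsPositive (P : Set E) T)
    (hTcomp : LyapunovPair.IsCompatible π (P : Set E) T)
    (𝒞 : Set (ℝ → E →L[ℝ] E)) (hT𝒞 : T ∈ 𝒞)
    (F : Set (StrongDual ℝ E)) (hF : LyapunovPair.IsStabilitySubset π (P : Set E) 𝒞 F)
    (z : E) (hz : LyapunovPair.IsL1Detector π (P : Set E) T F z) :
    List.TFAE [
      ∃ x : (LyapunovPair.generator T).domain,
        (x : E) ∈ P ∧ LyapunovPair.generator T x = -z,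
      LyapunovPair.IsL1Stable π (P : Set E) T,
      LyapunovPair.IsExpStable π T,
      LyapunovPair.HasNegPosBoundedInverse π (P : Set E) (LyapunovPair.generator T)] := by
  tfae_have 1 → 2 := by
    rintro ⟨x, hx, hxz⟩
    exact hF.2 T hT𝒞 hT hTpos hTcomp fun φ hφ => hz.2 φ hφ
      (LyapunovPair.lintegral_lt_top_of_generator_eq_neg hT hTpos hx hz.1 hxz (hF.1 hφ))
  tfae_have 2 → 3 := fun h => h.isExpStable hπ hgen hT hTcomp
  tfae_have 3 → 4 := fun h => h.hasNegPosBoundedInverse hE hπ P hT hTpos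
  tfae_have 4 → 1 := by
    rintro ⟨B, hAB, -, -, hpos⟩
    obtain ⟨hdom, heq⟩ := hAB (-z)
    refine ⟨⟨B (-z), hdom⟩, ?_, heq⟩
    change B (-z) ∈ P
    rw [map_neg]
    exact hpos z hz.1
  tfae_finish
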